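/- **Theorem (genie-aided converse).** Let $n\ge 1$, and let $X_1,X_2,\dots$ be i.i.d. random vectors in $\mathbb{R}^n$ whose law is the Gaussian mixture $\sum_{c=1}^K \pi_c\,\mathcal N(\mu_c,R_c)$, where $\pi_c\ge 0$, $\sum_c\pi_c=1$, $\mu_c\in\mathbb{R}^n$, and each $R_c$ is a (possibly singular) covariance matrix with eigenvalues $\lambda_{c,1},\dots,\lambda_{c,n}\ge 0$. A code of blocklength $m$ and rate $R\ge 0$ (in bits per source dimension) is a measurable encoder $f_m:(\mathbb{R}^n)^m\to\{1,\dots,\lfloor 2^{mnR}\rfloor\}$ with a decoder $g_m:\{1,\dots,\lfloor 2^{mnR}\rfloor\}\to(\mathbb{R}^n)^m$; its distortion is $\frac1{mn}\sum_{t=1}^m\mathbb{E}\|X_t-\hat X_t\|_2^2$, where $(\hat X_1,\dots,\hat X_m)=g_m(f_m(X_1,\dots,X_m))$. The rate $R$ is achievable at distortion $D$ if for every $\varepsilon>0$ and all sufficiently large $m$ there is a code of blocklength $m$ and rate $R$ with distortion at most $D+\varepsilon$. The operational rate–distortion function $R^\star(D)\in[0,\infty]$ is the infimum of the rates achievable at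 distortion $D$. For each $c$ let $R_c(\cdot)$ be the Gaussian rate–distortion function given by reverse waterfilling: $R_c(d)=\frac1n\sum_{i=1}^n\frac12\bigl[\log_2\frac{\lambda_{c,i}}{w}\bigr]_+$ for a level $w>0$ with $\frac1n\sum_{i=1}^n\min\{\lambda_{c,i},w\}=d$ if such a level exists, $R_c(d)=0$ if $d\ge\frac1n\sum_i\lambda_{c,i}$, and $R_c(0)=\infty$ if some $\lambda_{c,i}>0$. Let $$R_{\rm cond}(D)=\inf\Bigl\{\sum_{c=1}^K\pi_c R_c(D_c)\;:\;D_1,\dots,D_K\ge 0,\ \sum_{c=1}^K\pi_cD_c\le D\Bigr\}$$ (with $0\cdot\infty=0$) be the conditional benchmark in which the active component is known at both terminals. Then for every $D\ge 0$, $$R^\star(D)\ \ge\ R_{\rm cond}(D).$$ -/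

import Mathlib

open MeasureTheory ProbabilityTheory Filter
open scoped NNReal ENNReal

noncomputable section

/-- Parameters of a Gaussian mixture on `ℝⁿ` with `K` components: prior weights, component means and
component covariance matrices (singular covariances are allowed). -/
structure GaussianMixture (n K : ℕ) where
  /-- prior probability of component `c` -/
  weight : Fin K → ℝ≥0
  sum_weight : ∑ c, weight c = 1
  /-- mean of component `c` -/
  mean : Fin K → EuclideanSpace ℝ (Fin n)
  /-- covariance matrix of component `c` -/
  cov : Fin K → Matrix (Fin n) (Fin n) ℝ
  posSemidef_cov : ∀ c, (cov c).PosSemidef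

/-- The law of one source vector: the mixture `∑ c, π_c N(μ_c, R_c)`. -/
def GaussianMixture.law {n K : ℕ} (S : GaussianMixture n K) :
    Measure (EuclideanSpace ℝ (Fin n)) :=
  ∑ c, S.weight c • multivariateGaussian (S.mean c) (S.cov c)

/-- The eigenvalues `λ_{c,1}, …, λ_{c,n}` (with multiplicity) of the covariance of component `c`. -/
def GaussianMixture.eig {n K : ℕ} (S : GaussianMixture n K) (c : Fin K) : Fin n → ℝ :=
  (S.posSemidef_cov c).isHermitian.eigenvalues

/-- A block code of blocklength `m` and rate `R` bits per source dimension: an encoder into an index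
set with `⌊2 ^ (m n R)⌋` elements and a decoder. -/
structure SourceCode (n m : ℕ) (R : ℝ≥0) where
  /-- the encoder -/
  enc : (Fin m → EuclideanSpace ℝ (Fin n)) → Fin ⌊(2 : ℝ) ^ ((m : ℝ) * n * R)⌋₊
  measurable_enc : Measurable enc
  /-- the decoder -/
  dec : Fin ⌊(2 : ℝ) ^ ((m : ℝ) * n * R)⌋₊ → (Fin m → EuclideanSpace ℝ (Fin n))

/-- The per-dimension mean-squared error `(1 / (m n)) ∑ t, 𝔼 ‖X_t - X̂_t‖²` of a code, for
`X_1, …, X_m` i.i.d. with law `P` and `X̂ = dec (enc X)`. -/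
def SourceCode.distortion {n m : ℕ} {R : ℝ≥0} (φ : SourceCode n m R)
    (P : Measure (EuclideanSpace ℝ (Fin n))) : ℝ≥0∞ :=
  (∑ t, ∫⁻ x, ‖x t - φ.dec (φ.enc x) t‖ₑ ^ 2 ∂(Measure.pi fun _ : Fin m => P)) /
    ((m : ℝ≥0∞) * n)

/-- The rate `R` is achievable at distortion `D` for the memoryless source with marginal law `P`:
there are rate-`R` codes of all large blocklengths with asymptotic distortion at most `D`. -/
def IsAchievable {n : ℕ} (P : Measure (EuclideanSpace ℝ (Fin n))) (D R : ℝ≥0) : Prop :=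
  ∀ ε : ℝ≥0, 0 < ε → ∀ᶠ m in (atTop : Filter ℕ),
    ∃ φ : SourceCode n m R, φ.distortion P ≤ D + ε

/-- The operational rate-distortion function: the infimum of the rates achievable at distortion `D`
(`∞` if there is none). -/
def operationalRD {n : ℕ} (P : Measure (EuclideanSpace ℝ (Fin n))) (D : ℝ≥0) : ℝ≥0∞ :=
  ⨅ (R : ℝ≥0) (_ : IsAchievable P D R), (R : ℝ≥0∞)

/-- Per-dimension distortion of reverse waterfilling at level `w` with eigenvalues `ev`. -/
def waterDistortion {n : ℕ} (ev : Fin n → ℝ) (w : ℝ) : ℝ :=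
  (1 / n) * ∑ i, min (ev i) w

/-- Per-dimension rate (in bits) of reverse waterfilling at level `w` with eigenvalues `ev`. -/
def waterRate {n : ℕ} (ev : Fin n → ℝ) (w : ℝ) : ℝ :=
  (1 / n) * ∑ i, (1 / 2) * max (Real.logb 2 (ev i / w)) 0

/-- The Gaussian rate-distortion function at distortion `d`, for covariance eigenvalues `ev`, by
reverse waterfilling. Since the distortion increases and the rate decreases with the level, the
infimum is the rate at the level whose distortion is exactly `d`, when there is one; it is `0` when
`d` is at least the mean of the eigenvalues, and `∞` at `d = 0` unless all eigenvalues vanish. -/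
def gaussianRD {n : ℕ} (ev : Fin n → ℝ) (d : ℝ≥0) : ℝ≥0∞ :=
  ⨅ (w : ℝ) (_ : 0 < w) (_ : waterDistortion ev w ≤ d), ENNReal.ofReal (waterRate ev w)

/-- The genie-aided conditional benchmark: the infimum of `∑ c, π_c R_c(D_c)` over all allocations
`D_c ≥ 0` with `∑ c, π_c D_c ≤ D`. -/
def GaussianMixture.condRD {n K : ℕ} (S : GaussianMixture n K) (D : ℝ≥0) : ℝ≥0∞ :=
  ⨅ (d : Fin K → ℝ≥0) (_ : ∑ c, S.weight c * d c ≤ D),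
    ∑ c, (S.weight c : ℝ≥0∞) * gaussianRD (S.eig c) (d c)

end

/-!
The converse rests on the dual (tilting) form of the rate-distortion function, so that no mutual
information or differential entropy is needed. The genie is realised by the space of pairs
`(c, z)`, with `c` the component and `z` the coordinates of the centred source vector in the
eigenbasis of its covariance; under `GaussianMixture.genieLaw` the reconstructed source vector
`GaussianMixture.synth` has the mixture law (`map_synth_genieLaw`).

Suppose `ℓ ≥ 0` is a function of the genie variable with `𝔼 exp (ℓ - s ‖X - y‖²) ≤ 1` for every
point `y`. For `m` independent copies and a codebook of size `M`, the exponential of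
`∑ t, (ℓ_t - s ‖X_t - X̂_t‖²)` is at most the sum of the corresponding exponentials over all
codewords, whose expectation is at most `M`. Concavity of the logarithm then gives
`m 𝔼 ℓ ≤ s ∑ t, 𝔼 ‖X_t - X̂_t‖² + log M` (`lintegral_log_tilt_le_of_codebook`). As the code sees
only `X` while `ℓ` may depend on `c`, this bounds the code by the conditional benchmark.

For `s = 1 / (2 w)` the function `ℓ = GaussianMixture.logTilt w`, a sum over the coordinates of
`gaussianLogTilt`, is admissible, and its conditional expectation given `c` is `n` times
`waterRate · log 2 + s · waterDistortion` at level `w`. So an achievable pair `(D, R)` satisfies,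
for every `w > 0`, the Lagrangian inequality `lagrangian_le_of_isAchievable`. Choosing one common
level `w` at which the mean waterfilling distortion equals `D` makes the allocation
`D_c = waterDistortion` feasible, of mean rate at most `R`. No such level need exist in two cases:
if `D` is at least the mean of all variances, then the benchmark is `0`; if `D = 0` and some
variance of positive weight is nonzero, letting `w → 0` shows that no rate is achievable.
-/

/-! ### A converse for finite codebooks -/

theorem lintegral_pi_prod {ι : Type*} [Fintype ι] {Ω : ι → Type*} [∀ i, MeasurableSpace (Ω i)]
    (μ : ∀ i, Measure (Ω i)) [∀ i, IsProbabilityMeasure (μ i)] {f : ∀ i, Ω i → ℝ≥0∞}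
    (hf : ∀ i, Measurable (f i)) :
    ∫⁻ x, ∏ i, f i (x i) ∂(Measure.pi μ) = ∏ i, ∫⁻ x, f i x ∂(μ i) := by
  have hind : iIndepFun (fun i (x : ∀ i, Ω i) => f i (x i)) (Measure.pi μ) :=
    iIndepFun_pi (fun i => (hf i).aemeasurable)
  rw [lintegral_prod_eq_prod_lintegral_of_indepFun Finset.univ _ hind
    (fun i => (hf i).comp (measurable_pi_apply i))]
  exact Finset.prod_congr rfl fun i _ =>
    (measurePreserving_eval μ i).lintegral_comp (hf i)

theorem lintegral_pi_sum {ι : Type*} [Fintype ι] {Ω : ι → Type*} [∀ i, MeasurableSpace (Ω i)]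
    (μ : ∀ i, Measure (Ω i)) [∀ i, IsProbabilityMeasure (μ i)] {f : ∀ i, Ω i → ℝ≥0∞}
    (hf : ∀ i, Measurable (f i)) :
    ∫⁻ x, ∑ i, f i (x i) ∂(Measure.pi μ) = ∑ i, ∫⁻ x, f i x ∂(μ i) := by
  rw [lintegral_finsetSum Finset.univ (f := fun i (x : ∀ i, Ω i) => f i (x i))
    fun i _ => (hf i).comp (measurable_pi_apply i)]
  exact Finset.sum_congr rfl fun i _ =>
    (measurePreserving_eval μ i).lintegral_comp (hf i)

/-- The tangent-line form of `log x ≤ x / M - 1 + log M` at `x = exp (a - b)`. It replaces Jensen's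
inequality, and all terms being on the positive side, it can be integrated in `ℝ≥0∞`. -/
theorem add_one_le_add_exp_div_add_log {M : ℝ} (hM : 0 < M) (a b : ℝ) :
    a + 1 ≤ b + Real.exp (a - b) / M + Real.log M := by
  have h := Real.add_one_le_exp (a - b - Real.log M)
  rw [Real.exp_sub _ (Real.log M), Real.exp_log hM] at h
  linarith

/-- Converse for a code with codebook indexed by `ι`. The variable `ω` carries side information
beyond the source `X ω`; the weight `ℓ` may use it, whereas the encoder may not. -/
theorem lintegral_log_tilt_le_of_codebook {Ω E ι : Type*} [MeasurableSpace Ω]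
    [NormedAddCommGroup E] [MeasurableSpace E] [BorelSpace E] [SecondCountableTopology E]
    [Fintype ι] [Nonempty ι] [MeasurableSpace ι] [DiscreteMeasurableSpace ι]
    (Q : Measure Ω) [IsProbabilityMeasure Q] {X : Ω → E} (hX : Measurable X)
    {ℓ : Ω → ℝ} (hℓ : Measurable ℓ) (hℓ0 : ∀ ω, 0 ≤ ℓ ω) {s : ℝ} (hs : 0 ≤ s)
    (htilt : ∀ y, ∫⁻ ω, ENNReal.ofReal (Real.exp (ℓ ω - s * ‖X ω - y‖ ^ 2)) ∂Q ≤ 1)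
    {m : ℕ} {enc : (Fin m → E) → ι} (henc : Measurable enc) (dec : ι → Fin m → E) :
    m * ∫⁻ ω, ENNReal.ofReal (ℓ ω) ∂Q ≤
      ENNReal.ofReal s *
        (∑ t, ∫⁻ x, ‖x t - dec (enc x) t‖ₑ ^ 2 ∂(Measure.pi fun _ : Fin m => Q.map X)) +
      ENNReal.ofReal (Real.log (Fintype.card ι)) := by
  have hprob : IsProbabilityMeasure (Q.map X) := Measure.isProbabilityMeasure_map hX.aemeasurable
  have hM : (0 : ℝ) < Fintype.card ι := by exact_mod_cast Fintype.card_pos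
  have hM1 : (1 : ℝ) ≤ Fintype.card ι := by exact_mod_cast Fintype.card_pos
  have hdec : Measurable dec := measurable_of_countable dec
  have hXm : Measurable fun (ω : Fin m → Ω) t => X (ω t) := by fun_prop
  have herr : ∀ t, Measurable fun x : Fin m → E => ‖x t - dec (enc x) t‖ₑ ^ 2 := fun t =>
    (((measurable_pi_apply t).sub
      ((measurable_pi_apply t).comp (hdec.comp henc))).enorm).pow_const 2
  have hpull : ∀ t, ∫⁻ x, ‖x t - dec (enc x) t‖ₑ ^ 2 ∂(Measure.pi fun _ : Fin m => Q.map X) =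
      ∫⁻ ω, ‖X (ω t) - dec (enc fun t => X (ω t)) t‖ₑ ^ 2 ∂(Measure.pi fun _ : Fin m => Q) := by
    intro t
    rw [← Measure.pi_map_pi (fun _ => hX.aemeasurable), lintegral_map (herr t) hXm]
  have hpt : ∀ ω : Fin m → Ω, (∑ t, ENNReal.ofReal (ℓ (ω t))) + 1 ≤
      (ENNReal.ofReal s * (∑ t, ‖X (ω t) - dec (enc fun t => X (ω t)) t‖ₑ ^ 2) +
        ENNReal.ofReal (Real.log (Fintype.card ι))) +
      (∑ j, ∏ t, ENNReal.ofReal (Real.exp (ℓ (ω t) - s * ‖X (ω t) - dec j t‖ ^ 2))) *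
        ENNReal.ofReal (Fintype.card ι : ℝ)⁻¹ := by
    intro ω
    set j₀ := enc fun t => X (ω t)
    calc (∑ t, ENNReal.ofReal (ℓ (ω t))) + 1
        = ENNReal.ofReal ((∑ t, ℓ (ω t)) + 1) := by
          rw [ENNReal.ofReal_add (Finset.sum_nonneg fun t _ => hℓ0 _) zero_le_one,
            ENNReal.ofReal_sum_of_nonneg fun t _ => hℓ0 _, ENNReal.ofReal_one]
      _ ≤ ENNReal.ofReal ((s * (∑ t, ‖X (ω t) - dec j₀ t‖ ^ 2) + Real.log (Fintype.card ι)) +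
            (∏ t, Real.exp (ℓ (ω t) - s * ‖X (ω t) - dec j₀ t‖ ^ 2)) *
              (Fintype.card ι : ℝ)⁻¹) := by
          refine ENNReal.ofReal_le_ofReal ?_
          have h := add_one_le_add_exp_div_add_log hM (∑ t, ℓ (ω t))
            (s * ∑ t, ‖X (ω t) - dec j₀ t‖ ^ 2)
          rw [← Real.exp_sum, Finset.sum_sub_distrib, ← Finset.mul_sum, ← div_eq_mul_inv]
          linarith
      _ ≤ _ := by
          have hnn : 0 ≤ s * ∑ t, ‖X (ω t) - dec j₀ t‖ ^ 2 := by positivity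
          have hlog := Real.log_nonneg hM1
          rw [ENNReal.ofReal_add (by positivity) (by positivity), ENNReal.ofReal_add hnn hlog,
            ENNReal.ofReal_mul hs, ENNReal.ofReal_mul (by positivity),
            ENNReal.ofReal_sum_of_nonneg (fun _ _ => by positivity),
            ENNReal.ofReal_prod_of_nonneg (fun _ _ => by positivity)]
          simp only [ENNReal.ofReal_pow (norm_nonneg _), ofReal_norm]
          gcongr
          exact Finset.single_le_sum
            (f := fun j => ∏ t, ENNReal.ofReal (Real.exp (ℓ (ω t) - s * ‖X (ω t) - dec j t‖ ^ 2)))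
            (fun _ _ => zero_le) (Finset.mem_univ j₀)
  have hmeas : ∀ j t, Measurable fun ω : Ω =>
      ENNReal.ofReal (Real.exp (ℓ ω - s * ‖X ω - dec j t‖ ^ 2)) := fun j t => by fun_prop
  have hsum : ∫⁻ ω, ∑ j, ∏ t, ENNReal.ofReal (Real.exp (ℓ (ω t) - s * ‖X (ω t) - dec j t‖ ^ 2))
      ∂(Measure.pi fun _ : Fin m => Q) ≤ Fintype.card ι := by
    rw [lintegral_finsetSum _ fun j _ => by fun_prop]
    refine (Finset.sum_le_card_nsmul _ _ 1 fun j _ => ?_).trans (by simp)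
    rw [lintegral_pi_prod (fun _ : Fin m => Q) (hmeas j)]
    exact Finset.prod_le_one' fun t _ => htilt _
  have herrΩ : ∀ t, Measurable fun ω : Fin m → Ω =>
      ‖X (ω t) - dec (enc fun t => X (ω t)) t‖ₑ ^ 2 := fun t => (herr t).comp hXm
  have hint := lintegral_mono (μ := Measure.pi fun _ : Fin m => Q) hpt
  rw [lintegral_add_right _ measurable_const, lintegral_pi_sum (fun _ : Fin m => Q)
    (fun _ => hℓ.ennreal_ofReal), lintegral_add_right _ (by fun_prop),
    lintegral_add_right _ measurable_const, lintegral_const_mul _ (by fun_prop),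
    lintegral_finsetSum _ (fun t _ => herrΩ t), lintegral_mul_const _ (by fun_prop)] at hint
  simp only [lintegral_const, measure_univ, mul_one, Finset.sum_const, Finset.card_univ,
    Fintype.card_fin, nsmul_eq_mul] at hint
  rw [Finset.sum_congr rfl fun t _ => hpull t]
  refine (ENNReal.add_le_add_iff_right ENNReal.one_ne_top).1 (hint.trans ?_)
  gcongr
  calc _ ≤ (Fintype.card ι : ℝ≥0∞) * ENNReal.ofReal (Fintype.card ι : ℝ)⁻¹ := by gcongr
    _ = 1 := by
      rw [← ENNReal.ofReal_natCast, ← ENNReal.ofReal_mul hM.le, mul_inv_cancel₀ hM.ne',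
        ENNReal.ofReal_one]

/-! ### The dual weight of a scalar Gaussian -/

/-- The logarithm of the optimal dual weight at slope `1 / (2 w)` for squared error and a source
`N(0, v)`. For `v > w` it is minus the logarithm of `√(2πw)` times the density of `N(0, v)`, for
`v ≤ w` it is `z² / (2 w)`; the maximum covers both cases, including `v = 0`. -/
noncomputable def gaussianLogTilt (v : ℝ≥0) (w z : ℝ) : ℝ :=
  1 / 2 * Real.log (max (v : ℝ) w / w) + z ^ 2 / (2 * max (v : ℝ) w)

theorem measurable_gaussianLogTilt (v : ℝ≥0) (w : ℝ) : Measurable (gaussianLogTilt v w) := by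
  unfold gaussianLogTilt; fun_prop

theorem gaussianLogTilt_nonneg (v : ℝ≥0) {w : ℝ} (hw : 0 < w) (z : ℝ) :
    0 ≤ gaussianLogTilt v w z := by
  have h : 1 ≤ max (v : ℝ) w / w := (one_le_div hw).2 (le_max_right _ _)
  have := Real.log_nonneg h
  have : 0 < max (v : ℝ) w := lt_max_of_lt_right hw
  unfold gaussianLogTilt
  positivity

/-- Dual feasibility. For `v ≤ w` the integral is a Gaussian moment generating function; for `v > w`
the weight cancels the density of `N(0, v)` and leaves that of `N(y, w)`. -/
theorem lintegral_exp_gaussianLogTilt_le_one (v : ℝ≥0) {w : ℝ} (hw : 0 < w) (y : ℝ) :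
    ∫⁻ z, ENNReal.ofReal (Real.exp (gaussianLogTilt v w z - 1 / (2 * w) * (z - y) ^ 2))
      ∂(gaussianReal 0 v) ≤ 1 := by
  rcases le_or_gt (v : ℝ) w with hvw | hwv
  · have hexp : ∀ z, Real.exp (gaussianLogTilt v w z - 1 / (2 * w) * (z - y) ^ 2) =
        Real.exp (-(y ^ 2 / (2 * w))) * Real.exp (y / w * z) := by
      intro z
      rw [← Real.exp_add, gaussianLogTilt, max_eq_right hvw, div_self hw.ne', Real.log_one]
      congr 1
      field_simp
      ring
    have hmgf : ∫ z, Real.exp (y / w * z) ∂(gaussianReal 0 v) =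
        Real.exp (v * (y / w) ^ 2 / 2) := by
      have := congrFun (mgf_fun_id_gaussianReal (μ := 0) (v := v)) (y / w)
      simpa [mgf] using this
    simp_rw [hexp]
    rw [← ofReal_integral_eq_lintegral_ofReal ((integrable_exp_mul_gaussianReal _).const_mul _)
      (Eventually.of_forall fun z => by positivity), integral_const_mul, hmgf, ← Real.exp_add]
    refine ENNReal.ofReal_le_one.2 (Real.exp_le_one_iff.2 ?_)
    have : -(y ^ 2 / (2 * w)) + v * (y / w) ^ 2 / 2 = -((w - v) * y ^ 2 / (2 * w ^ 2)) := by
      field_simp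
      ring
    rw [this]
    have := sub_nonneg.2 hvw
    exact neg_nonpos.2 (by positivity)
  · have hv : 0 < (v : ℝ) := hw.trans hwv
    have hv0 : v ≠ 0 := by exact_mod_cast hv.ne'
    have hdens : ∀ z, ENNReal.ofReal (gaussianPDFReal 0 v z) *
        ENNReal.ofReal (Real.exp (gaussianLogTilt v w z - 1 / (2 * w) * (z - y) ^ 2)) =
        gaussianPDF y w.toNNReal z := by
      intro z
      rw [← ENNReal.ofReal_mul (gaussianPDFReal_nonneg _ _ _), gaussianPDF_def]
      simp only [gaussianPDFReal_def, gaussianLogTilt, max_eq_left hwv.le, sub_zero,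
        Real.coe_toNNReal w hw.le]
      congr 1
      have hlog : Real.exp (1 / 2 * Real.log (v / w)) = √(v / w) := by
        rw [Real.sqrt_eq_rpow, Real.rpow_def_of_pos (by positivity), mul_comm]
      have hsqrt : (√(2 * Real.pi * w))⁻¹ = (√(2 * Real.pi * v))⁻¹ * √(v / w) := by
        rw [← Real.sqrt_inv, ← Real.sqrt_inv, ← Real.sqrt_mul (by positivity)]
        congr 1
        field_simp
      rw [hsqrt, ← hlog, mul_assoc, ← Real.exp_add, mul_assoc (√_)⁻¹, ← Real.exp_add]
      congr 2
      field_simp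
      ring
    rw [gaussianReal_of_var_ne_zero _ hv0, lintegral_withDensity_eq_lintegral_mul _
      (measurable_gaussianPDF 0 v) (by have := measurable_gaussianLogTilt v w; fun_prop)]
    simp only [Pi.mul_apply, gaussianPDF_def 0 v, hdens]
    exact (lintegral_gaussianPDF_eq_one y (Real.toNNReal_pos.2 hw).ne').le

theorem lintegral_gaussianLogTilt (v : ℝ≥0) {w : ℝ} (hw : 0 < w) :
    ∫⁻ z, ENNReal.ofReal (gaussianLogTilt v w z) ∂(gaussianReal 0 v) =
      ENNReal.ofReal (1 / 2 * max (Real.log (v / w)) 0 + 1 / (2 * w) * min (v : ℝ) w) := by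
  have hsq : Integrable (fun z : ℝ => z ^ 2) (gaussianReal 0 v) :=
    (memLp_id_gaussianReal 2).integrable_sq
  have hsq_val : ∫ z, z ^ 2 ∂(gaussianReal 0 v) = v := by
    have := variance_of_integral_eq_zero (μ := gaussianReal 0 v) (X := id)
      aemeasurable_id (by simp)
    simpa using this.symm
  have hint : Integrable (gaussianLogTilt v w) (gaussianReal 0 v) :=
    (integrable_const _).add (hsq.div_const _)
  rw [← ofReal_integral_eq_lintegral_ofReal hint
    (Eventually.of_forall (gaussianLogTilt_nonneg v hw))]
  congr 1
  unfold gaussianLogTilt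
  rw [integral_add (integrable_const _) (hsq.div_const _), integral_div, hsq_val]
  simp only [integral_const, probReal_univ, one_smul]
  rcases le_or_gt (v : ℝ) w with hvw | hwv
  · have : Real.log (v / w) ≤ 0 :=
      Real.log_nonpos (by positivity) ((div_le_one hw).2 hvw)
    rw [max_eq_right hvw, max_eq_right this, min_eq_left hvw, div_self hw.ne', Real.log_one]
    ring
  · have hv : 0 < (v : ℝ) := hw.trans hwv
    have : 0 ≤ Real.log (v / w) := Real.log_nonneg ((one_le_div hw).2 hwv.le)
    rw [max_eq_left hwv.le, max_eq_left this, min_eq_right hwv.le]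
    field_simp

/-! ### Gaussian vectors in the eigenbasis of their covariance -/

/-- A centred Gaussian vector has independent coordinates in an eigenbasis of its covariance. -/
theorem multivariateGaussian_eq_map_pi {ι : Type*} [Fintype ι] [DecidableEq ι]
    (μ : EuclideanSpace ℝ ι) {S : Matrix ι ι ℝ} (hS : S.PosSemidef) :
    multivariateGaussian μ S =
      (Measure.pi fun i => gaussianReal 0 (hS.isHermitian.eigenvalues i).toNNReal).map
        (fun z => μ + ∑ i, z i • hS.isHermitian.eigenvectorBasis i) := by
  set b := hS.isHermitian.eigenvectorBasis
  have hmeas : Measurable fun z : ι → ℝ => μ + ∑ i, z i • b i := by fun_prop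
  have : IsProbabilityMeasure ((Measure.pi fun i =>
      gaussianReal 0 (hS.isHermitian.eigenvalues i).toNNReal).map
        (fun z => μ + ∑ i, z i • b i)) := Measure.isProbabilityMeasure_map hmeas.aemeasurable
  apply Measure.ext_of_charFun
  ext t
  have hquad : t.ofLp ⬝ᵥ S.mulVec t.ofLp =
      ∑ i, hS.isHermitian.eigenvalues i * inner ℝ (b i) t ^ 2 := by
    have hSt : WithLp.toLp 2 (S.mulVec t.ofLp) =
        ∑ i, (hS.isHermitian.eigenvalues i * inner ℝ (b i) t) • b i := by
      have h1 : WithLp.toLp 2 (S.mulVec t.ofLp) = Matrix.toEuclideanLin S t := rfl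
      conv_lhs => rw [h1, ← b.sum_repr' t]
      simp only [map_sum, map_smul]
      refine Finset.sum_congr rfl fun i _ => ?_
      have h2 : Matrix.toEuclideanLin S (b i) = hS.isHermitian.eigenvalues i • b i := by
        ext k
        exact congrFun (hS.isHermitian.mulVec_eigenvectorBasis i) k
      rw [h2, smul_smul, mul_comm]
    have h3 : t.ofLp ⬝ᵥ S.mulVec t.ofLp = inner ℝ (WithLp.toLp 2 (S.mulVec t.ofLp)) t := by
      simp [PiLp.inner_apply, dotProduct]
    rw [h3, hSt, sum_inner]
    refine Finset.sum_congr rfl fun i _ => ?_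
    rw [real_inner_smul_left]
    ring
  rw [charFun_multivariateGaussian hS, charFun_apply, integral_map hmeas.aemeasurable
    (Measurable.aestronglyMeasurable (by fun_prop)), hquad]
  simp_rw [inner_add_left, sum_inner, Complex.ofReal_add, Complex.ofReal_sum, add_mul,
    Finset.sum_mul, Complex.exp_add, Complex.exp_sum]
  rw [integral_const_mul, integral_fintype_prod_eq_prod
    (f := fun i (x : ℝ) => Complex.exp (inner ℝ (x • b i) t * Complex.I))]
  simp_rw [real_inner_smul_left, mul_comm _ (inner ℝ (b _) t), Complex.ofReal_mul,
    ← charFun_apply_real, charFun_gaussianReal]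
  rw [← Complex.exp_sum, sub_eq_add_neg, Complex.exp_add, real_inner_comm]
  congr 2
  rw [Finset.sum_div, ← Finset.sum_neg_distrib]
  refine Finset.sum_congr rfl fun i _ => ?_
  rw [Real.coe_toNNReal _ (hS.eigenvalues_nonneg i)]
  push_cast
  ring

/-! ### The mixture with revealed component -/

namespace GaussianMixture

variable {n K : ℕ} (S : GaussianMixture n K)

theorem eig_nonneg (c : Fin K) (i : Fin n) : 0 ≤ S.eig c i :=
  (S.posSemidef_cov c).eigenvalues_nonneg i

/-- An orthonormal eigenbasis of the covariance of component `c`, indexed compatibly with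
`GaussianMixture.eig`. -/
noncomputable def eigBasis (c : Fin K) :
    OrthonormalBasis (Fin n) ℝ (EuclideanSpace ℝ (Fin n)) :=
  (S.posSemidef_cov c).isHermitian.eigenvectorBasis

/-- The law, given component `c`, of the coordinates of the centred source vector in the
eigenbasis of component `c`. -/
noncomputable def coordLaw (c : Fin K) : Measure (Fin n → ℝ) :=
  Measure.pi fun i => gaussianReal 0 (S.eig c i).toNNReal

instance (c : Fin K) : IsProbabilityMeasure (S.coordLaw c) := by
  unfold coordLaw; infer_instance

/-- The joint law of the active component and of the eigenbasis coordinates of the centred source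
vector. -/
noncomputable def genieLaw : Measure (Fin K × (Fin n → ℝ)) :=
  ∑ c, S.weight c • (S.coordLaw c).map (Prod.mk c)

/-- The source vector as a function of the active component and of its eigenbasis coordinates. -/
noncomputable def synth (p : Fin K × (Fin n → ℝ)) : EuclideanSpace ℝ (Fin n) :=
  S.mean p.1 + ∑ i, p.2 i • S.eigBasis p.1 i

/-- The dual weight (as a logarithm) at slope `1 / (2 w)` of the source with known component: the
sum of the weights of the coordinates. -/
noncomputable def logTilt (w : ℝ) (p : Fin K × (Fin n → ℝ)) : ℝ :=
  ∑ i, gaussianLogTilt (S.eig p.1 i).toNNReal w (p.2 i)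

theorem measurable_synth : Measurable S.synth :=
  measurable_from_prod_countable_right fun c => by
    change Measurable fun z : Fin n → ℝ => S.mean c + ∑ i, z i • S.eigBasis c i
    fun_prop

theorem measurable_logTilt (w : ℝ) : Measurable (S.logTilt w) :=
  measurable_from_prod_countable_right fun c =>
    Finset.measurable_sum _ fun i _ =>
      (measurable_gaussianLogTilt (S.eig c i).toNNReal w).comp (measurable_pi_apply i)

theorem lintegral_genieLaw {f : Fin K × (Fin n → ℝ) → ℝ≥0∞} (hf : Measurable f) :
    ∫⁻ p, f p ∂S.genieLaw = ∑ c, (S.weight c : ℝ≥0∞) * ∫⁻ z, f (c, z) ∂(S.coordLaw c) := by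
  rw [genieLaw, lintegral_finsetSum_measure]
  refine Finset.sum_congr rfl fun c _ => ?_
  rw [lintegral_smul_measure, lintegral_map hf measurable_prodMk_left]
  rfl

theorem sum_coe_weight : ∑ c, (S.weight c : ℝ≥0∞) = 1 := by
  exact_mod_cast congrArg ((↑) : ℝ≥0 → ℝ≥0∞) S.sum_weight

instance : IsProbabilityMeasure S.genieLaw := by
  constructor
  rw [← lintegral_one, S.lintegral_genieLaw measurable_const]
  simp [S.sum_coe_weight]

theorem map_synth_genieLaw : S.genieLaw.map S.synth = S.law := by
  refine Measure.ext_of_lintegral _ fun f hf => ?_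
  have hX := S.measurable_synth
  rw [lintegral_map hf hX, S.lintegral_genieLaw (by fun_prop), law, lintegral_finsetSum_measure]
  refine Finset.sum_congr rfl fun c _ => ?_
  rw [lintegral_smul_measure, multivariateGaussian_eq_map_pi _ (S.posSemidef_cov c),
    lintegral_map hf (by fun_prop)]
  rfl

theorem norm_synth_sub_sq (c : Fin K) (z : Fin n → ℝ) (y : EuclideanSpace ℝ (Fin n)) :
    ‖S.synth (c, z) - y‖ ^ 2 = ∑ i, (z i - inner ℝ (S.eigBasis c i) (y - S.mean c)) ^ 2 := by
  rw [← (S.eigBasis c).sum_sq_inner_right]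
  refine Finset.sum_congr rfl fun i _ => ?_
  have h : S.synth (c, z) - y = ∑ j, z j • S.eigBasis c j - (y - S.mean c) := by
    simp only [synth]; abel
  rw [h, inner_sub_right, (S.eigBasis c).orthonormal.inner_right_fintype]

theorem lintegral_exp_logTilt_le_one {w : ℝ} (hw : 0 < w) (y : EuclideanSpace ℝ (Fin n)) :
    ∫⁻ p, ENNReal.ofReal (Real.exp (S.logTilt w p - 1 / (2 * w) * ‖S.synth p - y‖ ^ 2))
      ∂S.genieLaw ≤ 1 := by
  have hX := S.measurable_synth
  have hL := S.measurable_logTilt w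
  rw [S.lintegral_genieLaw (by fun_prop), ← S.sum_coe_weight]
  refine Finset.sum_le_sum fun c _ => mul_le_of_le_one_right' ?_
  simp_rw [norm_synth_sub_sq, logTilt, Finset.mul_sum, ← Finset.sum_sub_distrib, Real.exp_sum]
  simp_rw [ENNReal.ofReal_prod_of_nonneg fun i (_ : i ∈ Finset.univ) => (Real.exp_pos _).le]
  rw [coordLaw, lintegral_pi_prod _ (f := fun i z => ENNReal.ofReal (Real.exp
    (gaussianLogTilt (S.eig c i).toNNReal w z -
      1 / (2 * w) * (z - inner ℝ (S.eigBasis c i) (y - S.mean c)) ^ 2)))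
    (fun i => by have := measurable_gaussianLogTilt (S.eig c i).toNNReal w; fun_prop)]
  exact Finset.prod_le_one' fun i _ => lintegral_exp_gaussianLogTilt_le_one _ hw _

theorem lintegral_logTilt (hn : n ≠ 0) {w : ℝ} (hw : 0 < w) :
    ∫⁻ p, ENNReal.ofReal (S.logTilt w p) ∂S.genieLaw =
      ∑ c, (S.weight c : ℝ≥0∞) * ENNReal.ofReal (n * (waterRate (S.eig c) w * Real.log 2 +
        1 / (2 * w) * waterDistortion (S.eig c) w)) := by
  rw [S.lintegral_genieLaw (S.measurable_logTilt w).ennreal_ofReal]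
  refine Finset.sum_congr rfl fun c _ => ?_
  congr 1
  simp_rw [logTilt,
    ENNReal.ofReal_sum_of_nonneg fun i (_ : i ∈ Finset.univ) => gaussianLogTilt_nonneg _ hw _]
  rw [coordLaw, lintegral_pi_sum _
    (f := fun i z => ENNReal.ofReal (gaussianLogTilt (S.eig c i).toNNReal w z))
    (fun i => (measurable_gaussianLogTilt _ w).ennreal_ofReal)]
  simp_rw [lintegral_gaussianLogTilt _ hw, Real.coe_toNNReal _ (S.eig_nonneg c _)]
  rw [← ENNReal.ofReal_sum_of_nonneg fun i _ => by
    have := S.eig_nonneg c i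
    positivity]
  congr 1
  have hlog2 : 0 < Real.log 2 := Real.log_pos one_lt_two
  have hn' : (n : ℝ) ≠ 0 := by exact_mod_cast hn
  have hmax : ∀ i, max (Real.logb 2 (S.eig c i / w)) 0 * Real.log 2 =
      max (Real.log (S.eig c i / w)) 0 := fun i => by
    rw [max_mul_of_nonneg _ _ hlog2.le, zero_mul, Real.logb, div_mul_cancel₀ _ hlog2.ne']
  simp_rw [← hmax, Finset.sum_add_distrib, waterRate, waterDistortion, ← Finset.mul_sum,
    ← Finset.sum_mul]
  field_simp

end GaussianMixture

/-! ### The Lagrangian bound and the choice of the water level -/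

theorem waterRate_nonneg {n : ℕ} (ev : Fin n → ℝ) (w : ℝ) : 0 ≤ waterRate ev w := by
  unfold waterRate; positivity

theorem waterDistortion_nonneg {n : ℕ} {ev : Fin n → ℝ} (hev : ∀ i, 0 ≤ ev i) {w : ℝ}
    (hw : 0 ≤ w) : 0 ≤ waterDistortion ev w := by
  unfold waterDistortion
  exact mul_nonneg (by positivity) (Finset.sum_nonneg fun i _ => le_min (hev i) hw)

namespace GaussianMixture

variable {n K : ℕ} (S : GaussianMixture n K)

/-- The Lagrangian lower bound at slope `1 / (2 w)`, common to all components, in nats. -/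
theorem lagrangian_le_of_isAchievable (hn : n ≠ 0) {D R : ℝ≥0} (h : IsAchievable S.law D R)
    {w : ℝ} (hw : 0 < w) :
    ∑ c, (S.weight c : ℝ) * (waterRate (S.eig c) w * Real.log 2 +
        1 / (2 * w) * waterDistortion (S.eig c) w) ≤
      1 / (2 * w) * D + R * Real.log 2 := by
  set A : Fin K → ℝ := fun c => waterRate (S.eig c) w * Real.log 2 +
    1 / (2 * w) * waterDistortion (S.eig c) w with hA
  have hA0 : ∀ c, 0 ≤ A c := fun c => by
    have := waterRate_nonneg (S.eig c) w
    have := waterDistortion_nonneg (S.eig_nonneg c) hw.le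
    have := Real.log_nonneg one_le_two
    simp only [hA]
    positivity
  refine le_of_forall_pos_le_add fun δ hδ => ?_
  -- slack `ε` in the distortion costs `ε / (2 w) = δ` in the bound
  set ε : ℝ≥0 := (2 * w * δ).toNNReal
  have hεpos : 0 < ε := Real.toNNReal_pos.2 (by positivity)
  obtain ⟨m, ⟨φ, hφ⟩, hm⟩ := ((h ε hεpos).and (eventually_gt_atTop 0)).exists
  have hm' : (0 : ℝ) < m := by exact_mod_cast hm
  have hn' : (0 : ℝ) < n := by exact_mod_cast Nat.pos_of_ne_zero hn
  set B : ℝ := (2 : ℝ) ^ ((m : ℝ) * n * R)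
  have hB : 1 ≤ B := Real.one_le_rpow one_le_two (by positivity)
  have hNpos : 0 < ⌊B⌋₊ := Nat.floor_pos.2 hB
  have : Nonempty (Fin ⌊B⌋₊) := ⟨⟨0, hNpos⟩⟩
  have key := lintegral_log_tilt_le_of_codebook S.genieLaw S.measurable_synth
    (S.measurable_logTilt w)
    (fun p => Finset.sum_nonneg fun i _ => gaussianLogTilt_nonneg _ hw _)
    (show 0 ≤ 1 / (2 * w) by positivity) (S.lintegral_exp_logTilt_le_one hw)
    φ.measurable_enc φ.dec
  rw [S.map_synth_genieLaw, S.lintegral_logTilt hn hw, Fintype.card_fin] at key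
  have hdist : (∑ t, ∫⁻ x, ‖x t - φ.dec (φ.enc x) t‖ₑ ^ 2 ∂(Measure.pi fun _ : Fin m => S.law)) ≤
      ENNReal.ofReal ((D + ε) * (m * n)) := by
    rw [SourceCode.distortion, ENNReal.div_le_iff (by simp [hm.ne', hn])
      (ENNReal.mul_ne_top (by simp) (by simp))] at hφ
    refine hφ.trans_eq ?_
    rw [ENNReal.ofReal_mul (by positivity), ENNReal.ofReal_mul (by positivity),
      ENNReal.ofReal_add (by positivity) (by positivity)]
    simp
  have hlog : Real.log (⌊B⌋₊ : ℝ) ≤ m * n * R * Real.log 2 := by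
    rw [← Real.log_rpow two_pos]
    exact Real.log_le_log (by exact_mod_cast hNpos) (Nat.floor_le (zero_le_one.trans hB))
  have hlhs : (m : ℝ≥0∞) * ∑ c, (S.weight c : ℝ≥0∞) * ENNReal.ofReal (n * A c) =
      ENNReal.ofReal (m * n * ∑ c, (S.weight c : ℝ) * A c) := by
    have hterm : ∀ c, (S.weight c : ℝ≥0∞) * ENNReal.ofReal (n * A c) =
        ENNReal.ofReal (n * (S.weight c * A c)) := fun c => by
      rw [mul_left_comm, ENNReal.ofReal_mul (p := (S.weight c : ℝ)) (by positivity),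
        ENNReal.ofReal_coe_nnreal]
    rw [Finset.sum_congr rfl fun c _ => hterm c, ← ENNReal.ofReal_sum_of_nonneg
      (fun c _ => by have := hA0 c; positivity), ← ENNReal.ofReal_natCast m,
      ← ENNReal.ofReal_mul (by positivity), ← Finset.mul_sum, mul_assoc]
  have hfin : ENNReal.ofReal (m * n * ∑ c, (S.weight c : ℝ) * A c) ≤
      ENNReal.ofReal (1 / (2 * w) * ((D + ε) * (m * n)) + m * n * R * Real.log 2) := by
    have := Real.log_nonneg one_le_two
    rw [← hlhs, ENNReal.ofReal_add (by positivity) (by positivity),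
      ENNReal.ofReal_mul (by positivity)]
    refine key.trans ?_
    gcongr
  rw [ENNReal.ofReal_le_ofReal_iff
    (by have := Real.log_nonneg one_le_two; positivity)] at hfin
  have hεval : (ε : ℝ) = 2 * w * δ := Real.coe_toNNReal _ (by positivity)
  refine le_of_mul_le_mul_left (hfin.trans_eq ?_) (mul_pos hm' hn')
  rw [hεval]
  field_simp
  ring

/-- The average over the components of the waterfilling distortions at the common level `w`. -/
noncomputable def meanDistortion (w : ℝ) : ℝ :=
  ∑ c, (S.weight c : ℝ) * waterDistortion (S.eig c) w

/-- The average over the components of the waterfilling rates at the common level `w`. -/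
noncomputable def meanRate (w : ℝ) : ℝ :=
  ∑ c, (S.weight c : ℝ) * waterRate (S.eig c) w

theorem meanRate_le_of_isAchievable (hn : n ≠ 0) {D R : ℝ≥0} (h : IsAchievable S.law D R)
    {w : ℝ} (hw : 0 < w) (hD : D ≤ S.meanDistortion w) : S.meanRate w ≤ R := by
  have hlag := S.lagrangian_le_of_isAchievable hn h hw
  have hsplit : ∑ c, (S.weight c : ℝ) * (waterRate (S.eig c) w * Real.log 2 +
      1 / (2 * w) * waterDistortion (S.eig c) w) =
      S.meanRate w * Real.log 2 + 1 / (2 * w) * S.meanDistortion w := by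
    rw [meanRate, meanDistortion, Finset.sum_mul, Finset.mul_sum, ← Finset.sum_add_distrib]
    exact Finset.sum_congr rfl fun c _ => by ring
  have hmul : 1 / (2 * w) * D ≤ 1 / (2 * w) * S.meanDistortion w := by gcongr
  refine le_of_mul_le_mul_right ?_ (Real.log_pos one_lt_two)
  linarith

/-- The waterfilling distortions at a common level form an allocation for the benchmark. -/
theorem condRD_le_meanRate {D : ℝ≥0} {w : ℝ} (hw : 0 < w) (hD : S.meanDistortion w ≤ D) :
    S.condRD D ≤ ENNReal.ofReal (S.meanRate w) := by
  have hd := fun c => waterDistortion_nonneg (S.eig_nonneg c) hw.le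
  refine (iInf₂_le (fun c => (waterDistortion (S.eig c) w).toNNReal) ?_).trans ?_
  · rw [← NNReal.coe_le_coe]
    push_cast
    simpa only [Real.coe_toNNReal _ (hd _), meanDistortion] using hD
  · rw [meanRate, ENNReal.ofReal_sum_of_nonneg fun c _ =>
      mul_nonneg (S.weight c).coe_nonneg (waterRate_nonneg (S.eig c) w)]
    refine Finset.sum_le_sum fun c _ => ?_
    rw [ENNReal.ofReal_mul (S.weight c).coe_nonneg, ENNReal.ofReal_coe_nnreal]
    gcongr
    exact iInf_le_of_le w (iInf₂_le hw (Real.coe_toNNReal _ (hd c)).ge)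

theorem continuous_meanDistortion : Continuous S.meanDistortion := by
  unfold meanDistortion waterDistortion
  fun_prop

theorem meanDistortion_le (hn : n ≠ 0) (w : ℝ) : S.meanDistortion w ≤ w := by
  have hn' : (0 : ℝ) < n := by exact_mod_cast Nat.pos_of_ne_zero hn
  have hwater : ∀ c, waterDistortion (S.eig c) w ≤ w := fun c => by
    have hsum : ∑ i, min (S.eig c i) w ≤ n * w := by
      simpa using Finset.sum_le_sum fun i (_ : i ∈ Finset.univ) => min_le_right (S.eig c i) w
    calc waterDistortion (S.eig c) w ≤ 1 / n * (n * w) := by unfold waterDistortion; gcongr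
      _ = w := by field_simp
  have hsum : ∑ c, (S.weight c : ℝ) = 1 := by exact_mod_cast S.sum_weight
  calc S.meanDistortion w ≤ ∑ c, (S.weight c : ℝ) * w := by
        unfold meanDistortion; gcongr with c; exact hwater c
    _ = w := by rw [← Finset.sum_mul, hsum, one_mul]

theorem meanRate_eq_zero {w : ℝ} (hw : 0 < w) (h : ∀ c i, S.eig c i ≤ w) : S.meanRate w = 0 := by
  refine Finset.sum_eq_zero fun c _ => ?_
  rw [waterRate, Finset.sum_eq_zero, mul_zero, mul_zero]
  intro i _
  rw [max_eq_right, mul_zero]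
  exact Real.logb_nonpos one_lt_two (div_nonneg (S.eig_nonneg c i) hw.le)
    ((div_le_one hw).2 (h c i))

/-- If some component of positive weight is not deterministic, the mean rate is unbounded as the
level tends to `0`. -/
theorem exists_lt_meanRate {w₀ : ℝ} (h : 0 < S.meanDistortion w₀) (r : ℝ) :
    ∃ w, 0 < w ∧ r < S.meanRate w := by
  obtain ⟨c, -, hc⟩ := Finset.exists_lt_of_sum_lt (s := Finset.univ) (f := fun _ : Fin K => (0 : ℝ))
    (by simpa [meanDistortion] using h)
  have hwt : 0 < (S.weight c : ℝ) :=
    lt_of_le_of_ne (S.weight c).coe_nonneg fun h0 => by simp [← h0] at hc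
  have hdist : 0 < waterDistortion (S.eig c) w₀ := pos_of_mul_pos_right hc hwt.le
  have hn : (0 : ℝ) < n := by
    rcases Nat.eq_zero_or_pos n with rfl | hn
    · simp [waterDistortion] at hdist
    · exact_mod_cast hn
  obtain ⟨i, -, hi⟩ := Finset.exists_lt_of_sum_lt (s := Finset.univ) (f := fun _ : Fin n => (0 : ℝ))
    (by simpa using pos_of_mul_pos_right hdist (by positivity : (0 : ℝ) ≤ 1 / n))
  have heig : 0 < S.eig c i := hi.trans_le (min_le_left _ _)
  -- the level at which eigenvalue `i` of component `c` alone contributes `|r| + 1` bits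
  set a : ℝ := 2 * n * ((|r| + 1) / S.weight c) with ha
  refine ⟨S.eig c i / 2 ^ a, by positivity, ?_⟩
  set w := S.eig c i / 2 ^ a with hw
  have hterm : a / 2 ≤ ∑ j, 1 / 2 * max (Real.logb 2 (S.eig c j / w)) 0 := by
    have hlog : Real.logb 2 (S.eig c i / w) = a := by
      rw [hw, div_div_cancel₀ heig.ne', Real.logb_rpow two_pos (by norm_num)]
    have hi' : a / 2 ≤ 1 / 2 * max (Real.logb 2 (S.eig c i / w)) 0 := by
      rw [hlog]
      linarith [le_max_left a 0]
    exact hi'.trans (Finset.single_le_sum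
      (f := fun j => 1 / 2 * max (Real.logb 2 (S.eig c j / w)) 0)
      (fun j _ => by positivity) (Finset.mem_univ i))
  have hrate : (|r| + 1) / S.weight c ≤ waterRate (S.eig c) w := by
    calc (|r| + 1) / S.weight c = 1 / n * (a / 2) := by rw [ha]; field_simp
      _ ≤ waterRate (S.eig c) w := by unfold waterRate; gcongr
  calc r < |r| + 1 := (le_abs_self r).trans_lt (lt_add_one _)
    _ ≤ S.weight c * waterRate (S.eig c) w := by rwa [div_le_iff₀' hwt] at hrate
    _ ≤ S.meanRate w := Finset.single_le_sum
      (f := fun c => (S.weight c : ℝ) * waterRate (S.eig c) w)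
      (fun c _ => mul_nonneg (S.weight c).coe_nonneg (waterRate_nonneg _ _)) (Finset.mem_univ c)

end GaussianMixture

/-! ### The converse -/

theorem theorem2 (n K : ℕ) (hn : 1 ≤ n) (S : GaussianMixture n K) (D : ℝ≥0) :
    S.condRD D ≤ operationalRD S.law D := by
  have hn0 : n ≠ 0 := Nat.one_le_iff_ne_zero.1 hn
  refine le_iInf₂ fun R hR => ?_
  obtain ⟨W, hW, heig⟩ : ∃ W : ℝ, 0 < W ∧ ∀ c i, S.eig c i ≤ W := by
    obtain ⟨M, hM⟩ := Finite.bddAbove_range fun p : Fin K × Fin n => S.eig p.1 p.2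
    exact ⟨max M 1, by positivity, fun c i => (hM ⟨(c, i), rfl⟩).trans (le_max_left _ _)⟩
  rcases le_or_gt (S.meanDistortion W) D with hWD | hDW
  · refine (S.condRD_le_meanRate hW hWD).trans ?_
    simp [S.meanRate_eq_zero hW heig]
  rcases eq_zero_or_pos D with rfl | hD
  · obtain ⟨w, hw, hlt⟩ := S.exists_lt_meanRate hDW R
    have hdist : ((0 : ℝ≥0) : ℝ) ≤ S.meanDistortion w := Finset.sum_nonneg fun c _ =>
      mul_nonneg (S.weight c).coe_nonneg (waterDistortion_nonneg (S.eig_nonneg c) hw.le)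
    exact absurd (S.meanRate_le_of_isAchievable hn0 hR hw hdist) hlt.not_ge
  · have hDpos : (0 : ℝ) < D := hD
    obtain ⟨w, hw, hwD⟩ := intermediate_value_Icc (min_le_right (D : ℝ) W)
      S.continuous_meanDistortion.continuousOn
      ⟨(S.meanDistortion_le hn0 _).trans (min_le_left _ _), hDW.le⟩
    have hw0 : 0 < w := (lt_min hDpos hW).trans_le hw.1
    calc S.condRD D ≤ ENNReal.ofReal (S.meanRate w) := S.condRD_le_meanRate hw0 hwD.le
      _ ≤ ENNReal.ofReal R :=
        ENNReal.ofReal_le_ofReal (S.meanRate_le_of_isAchievable hn0 hR hw0 hwD.ge)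
      _ = R := ENNReal.ofReal_coe_nnreal
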